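/- Setting. Let $(\Delta,\mathfrak D,\mathbb P)$ be a probability space, $\mathcal Z$ a set (of decisions) and $m\ge 1$ an integer. For $i=1,\dots,m$ and $\delta\in\Delta$ let $\mathcal Z_i(\delta)\subseteq\mathcal Z$ be the set of decisions appropriate for criterion $i$ under $\delta$. A dataset $\mathcal D_i$ is a finite list of elements of $\Delta$ (possibly empty), and a decision scheme is a map $\mathcal M$ assigning a decision $\mathcal M(\mathcal D_1,\dots,\mathcal D_m)\in\mathcal Z$ to all lists $\mathcal D_1,\dots,\mathcal D_m$. It is assumed that, for all dataset sizes and all $i$, the set of pairs (data, $\delta$) with $\mathcal M(\text{data})\in\mathcal Z_i(\delta)$ is measurable. The joint risk of $z\in\mathcal Z$ is $V(z)=\mathbb P\{\delta: z\notin\mathcal Z_1(\delta)\ \lor\cdots\lor\ z\notin\mathcal Z_m(\delta)\}$. A scenario $\delta_i^{(j)}$ of $\mathcal D_i$ is a support scenario if removing it, while keeping all other scenarios, changes the decision. Let $\mathcal S_i$ be the sub-list of support scenarios of $\mathcal D_i$; the complexity is $\boldsymbol s^\star=(|\mathcal S_1|,\dots,|\mathcal S_m|)$. Assumption 1. For all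 lists $\mathcal D_i,\widetilde{\mathcal D}_i$ (possibly empty), $i=1,\dots,m$, with $\mathcal D_i^+=\mathcal D_i\cup\widetilde{\mathcal D}_i$ denoting concatenation: (i) $\mathcal M(\mathcal D_1,\dots,\mathcal D_m)$ does not change if each $\mathcal D_i$ is permuted; (ii) if $\mathcal M(\mathcal D_1,\dots,\mathcal D_m)\in\mathcal Z_i(\delta)$ for all $\delta\in\widetilde{\mathcal D}_i$ and all $i$, then $\mathcal M(\mathcal D_1^+,\dots,\mathcal D_m^+)=\mathcal M(\mathcal D_1,\dots,\mathcal D_m)$; (iii) if $\mathcal M(\mathcal D_1,\dots,\mathcal D_m)\notin\mathcal Z_i(\delta)$ for some $i$ and some $\delta\in\widetilde{\mathcal D}_i$, then $\mathcal M(\mathcal D_1^+,\dots,\mathcal D_m^+)\ne\mathcal M(\mathcal D_1,\dots,\mathcal D_m)$. Assumption 2 (non-degeneracy). For every $\boldsymbol N=(N_1,\dots,N_m)$ of positive integers, if the $|\boldsymbol N|=N_1+\dots+N_m$ scenarios are i.i.d. with law $\mathbb P$, then $\mathcal M(\mathcal S_1,\dots,\mathcal S_m)=\mathcal M(\mathcal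 D_1,\dots,\mathcal D_m)$ with probability one. Notation. For $\beta\in(0,1)$, $\boldsymbol N\in\mathbb N^m$ (positive integers) and $\boldsymbol 0\le\boldsymbol k\le\boldsymbol N\le\boldsymbol H$ integer vectors, put $\mathcal J_{\boldsymbol k}=\{\max_i(k_i-N_i),\dots,\min_i(H_i-N_i)\}$ and $$\psi_{\boldsymbol k,\boldsymbol N,\boldsymbol H}(t)=1-\frac{\beta}{|\mathcal J_{\boldsymbol 0}|-1}\sum_{j\in\mathcal J_{\boldsymbol k}\setminus\{0\}}\ \prod_{i=1}^m\frac{\binom{N_i+j}{k_i}}{\binom{N_i}{k_i}}\;t^j .$$ Take $\boldsymbol H=\boldsymbol N$ and $\hat t=\prod_{i=1}^m(1-k_i/N_i)$. If $k_i<N_i$ for all $i$, then $\bar t_{\boldsymbol k}$ is the zero of $\psi_{\boldsymbol k,\boldsymbol N,\boldsymbol N}$ in $(0,\hat t)$; otherwise $\bar t_{\boldsymbol k}=0$. Proposition. Let $\boldsymbol N\in\mathbb N^m$ and $\beta\in(0,1)$. If $k_i<N_i$ for all $i$, then $\psi_{\boldsymbol k,\boldsymbol N,\boldsymbol N}$ has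 exactly one zero in $(0,\hat t)$, so that $\bar t_{\boldsymbol k}$ is well defined. Under Assumptions 1 and 2, the decision $z_{\boldsymbol N}^\star=\mathcal M(\mathcal D_1,\dots,\mathcal D_m)$ computed from $|\boldsymbol N|$ i.i.d. scenarios ($N_i$ of them in $\mathcal D_i$), with complexity $\boldsymbol s^\star_{\boldsymbol N}$, satisfies $$\mathbb P^{|\boldsymbol N|}\{V(z_{\boldsymbol N}^\star)\le\bar\varepsilon(\boldsymbol s_{\boldsymbol N}^\star)\}\ge 1-\beta,\qquad \bar\varepsilon(\boldsymbol k)=\min\bigl\{m\bigl(1-\sqrt[m]{\bar t_{\boldsymbol k}}\bigr),\,1\bigr\}.$$ -/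

import Mathlib

open MeasureTheory Set

namespace MultiCriteria

/-!
`Δ` is the uncertainty space and `𝒵` the decision space. The datasets `𝒟₁, …, 𝒟ₘ` are a family
`D : Fin m → List Δ`; the label of a scenario is the index of the list that contains it, and lists
may be empty. `A i δ` is the set of decisions appropriate for criterion `i` under `δ`. A decision
scheme is a map `M : (Fin m → List Δ) → 𝒵`.
-/

/-- Permutation invariance and the two consistency conditions of a decision scheme. -/
structure IsConsistentScheme {m : ℕ} {Δ : Type*} {𝒵 : Type*}
    (A : Fin m → Δ → Set 𝒵) (M : (Fin m → List Δ) → 𝒵) : Prop where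
  /-- Permuting each dataset does not change the decision. -/
  perm_invariant : ∀ D D' : Fin m → List Δ, (∀ i, (D' i).Perm (D i)) → M D' = M D
  /-- Stability in case of confirmation. -/
  stable : ∀ D E : Fin m → List Δ,
    (∀ i, ∀ δ ∈ E i, M D ∈ A i δ) → M (fun i => D i ++ E i) = M D
  /-- Responsiveness to contradiction. -/
  responsive : ∀ D E : Fin m → List Δ,
    (∃ i, ∃ δ ∈ E i, M D ∉ A i δ) → M (fun i => D i ++ E i) ≠ M D

/-- The joint risk `V(z)`: the probability that `z` is inappropriate for some criterion. -/
noncomputable def jointRisk {m : ℕ} {Δ : Type*} [MeasurableSpace Δ] {𝒵 : Type*}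
    (P : Measure Δ) (A : Fin m → Δ → Set 𝒵) (z : 𝒵) : ℝ :=
  P.real {δ | ∃ i, z ∉ A i δ}

/-- The `j`-th scenario of the `i`-th dataset is a support scenario: removing it, while keeping
all the others, changes the decision. -/
def IsSupport {m : ℕ} {Δ : Type*} {𝒵 : Type*} (M : (Fin m → List Δ) → 𝒵)
    (D : Fin m → List Δ) (i : Fin m) (j : Fin (D i).length) : Prop :=
  M (Function.update D i ((D i).eraseIdx j)) ≠ M D

open Classical in
/-- The lists `𝒮₁, …, 𝒮ₘ` of support scenarios, in their original order. -/
noncomputable def supportLists {m : ℕ} {Δ : Type*} {𝒵 : Type*} (M : (Fin m → List Δ) → 𝒵)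
    (D : Fin m → List Δ) : Fin m → List Δ := fun i =>
  ((List.finRange (D i).length).filter (fun j => IsSupport M D i j)).map (D i).get

/-- The complexity: the vector of the numbers of support scenarios. -/
noncomputable def complexity {m : ℕ} {Δ : Type*} {𝒵 : Type*} (M : (Fin m → List Δ) → 𝒵)
    (D : Fin m → List Δ) : Fin m → ℕ := fun i => (supportLists M D i).length

/-- The datasets, as lists, made of the scenarios `ω i 0, …, ω i (N i - 1)`. -/
def toData {m : ℕ} {Δ : Type*} {N : Fin m → ℕ} (ω : (i : Fin m) → Fin (N i) → Δ) :
    Fin m → List Δ := fun i => List.ofFn (ω i)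

/-- The law `ℙ^{|N|}` of the scenarios: all of them, within and across datasets, are
independent with law `P`. -/
noncomputable def sampleLaw {m : ℕ} {Δ : Type*} [MeasurableSpace Δ] (P : Measure Δ)
    (N : Fin m → ℕ) : Measure ((i : Fin m) → Fin (N i) → Δ) :=
  Measure.pi fun i => Measure.pi fun _ : Fin (N i) => P

/-- Non-degeneracy: for all dataset sizes `N ≥ 1`, the support scenarios alone give the same
decision as all the data, with probability one. -/
def NonDegenerate {m : ℕ} {Δ : Type*} [MeasurableSpace Δ] {𝒵 : Type*} (P : Measure Δ)
    (M : (Fin m → List Δ) → 𝒵) : Prop :=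
  ∀ N : Fin m → ℕ, (∀ i, 0 < N i) →
    ∀ᵐ ω ∂(sampleLaw P N), M (supportLists M (toData ω)) = M (toData ω)

/-- Measurability of appropriateness of the data-driven decision for a further realization `δ`,
jointly in the data and `δ`. -/
def IsMeasurableScheme {m : ℕ} {Δ : Type*} [MeasurableSpace Δ] {𝒵 : Type*}
    (A : Fin m → Δ → Set 𝒵) (M : (Fin m → List Δ) → 𝒵) : Prop :=
  ∀ (N : Fin m → ℕ) (i : Fin m),
    MeasurableSet {p : ((l : Fin m) → Fin (N l) → Δ) × Δ | M (toData p.1) ∈ A i p.2}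

/-- The set of integers `𝒥_k = {max (k - N), …, min (H - N)}`. -/
noncomputable def indexRange {m : ℕ} (k N H : Fin m → ℕ) : Finset ℤ :=
  Finset.Icc (⨆ i, ((k i : ℤ) - (N i : ℤ))) (⨅ i, ((H i : ℤ) - (N i : ℤ)))

/-- The multi-index binomial `binom(N + j 𝟏, k)`; only used when `N + j 𝟏 ≥ k`. -/
def shiftedChoose {m : ℕ} (N k : Fin m → ℕ) (j : ℤ) : ℕ :=
  ∏ i, ((N i : ℤ) + j).toNat.choose (k i)

/-- The function `ψ_{k,N,H}`. -/
noncomputable def psi {m : ℕ} (β : ℝ) (k N H : Fin m → ℕ) (t : ℝ) : ℝ :=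
  1 - β / (((indexRange 0 N H).card : ℝ) - 1) *
    ∑ j ∈ (indexRange k N H).erase 0,
      (shiftedChoose N k j : ℝ) / (shiftedChoose N k 0 : ℝ) * t ^ j

/-- `t̂ = ∏ i, (1 - k i / N i)`. -/
noncomputable def tHat {m : ℕ} (k N : Fin m → ℕ) : ℝ := ∏ i, (1 - (k i : ℝ) / (N i : ℝ))

open Classical in
/-- `t̄_k`: the unique zero of `ψ_{k,N,H}` in `(0, t̂)` if `k i < N i` for all `i`, and `0`
otherwise. -/
noncomputable def tBar {m : ℕ} (β : ℝ) (k N H : Fin m → ℕ) : ℝ :=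
  if ∀ i, k i < N i then sInf {t | t ∈ Ioo 0 (tHat k N) ∧ psi β k N H t = 0} else 0

/-- `ε̄(k) = min {m (1 - t̄_k^{1/m}), 1}`, where `t̄_k` is taken with `H = N`. -/
noncomputable def epsBar {m : ℕ} (β : ℝ) (N k : Fin m → ℕ) : ℝ :=
  min ((m : ℝ) * (1 - tBar β k N N ^ (1 / (m : ℝ)))) 1

end MultiCriteria

namespace MultiCriteria

/-! Treat all scenarios as one i.i.d. family indexed by (label, position). Let `z_T` be the decision
from a subset `T` of it and `a_i(z)` the probability that `z` is appropriate for criterion `i`. By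
consistency `z_U = z_T` for `T ⊆ U` exactly when the scenarios in `U \ T` confirm `z_T`;
conditionally on `T` this has probability `∏ a_{label x}(z_T)` over `x ∈ U \ T`. By non-degeneracy
the support set is almost surely the only irreducible `T` that reproduces the full decision.

Hence the probability that `∏ a_i < t̄` is at most a sum over `T` of integrals of confirmation
probabilities, while for each `U` the analogous integrals over `T ⊆ U` sum to at most 1
(`sum_lintegral_le_one`). This is a linear program, and weights on the sets `U` certify an upper
bound by weak duality (`measure_supportSet_le`).

The weights put mass `β / n`, `n = min N_i`, uniformly on the sets missing `j` scenarios of each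
label, `j = 1, …, n`. Removing equally many of each label makes only `p = ∏ a_i` matter: dual
feasibility becomes `ψ(p) ≤ 0`, true for `p < t̄` because `ψ` increases (`le_sum_dualWeight`).
Finally, the union bound and AM-GM turn `V > ε̄` into `∏ a_i < t̄` (`prod_lt_tBar`). -/

/-- A family of decisions `z ω T`, made from the scenarios `ω x`, `x ∈ T`, where the scenario `ω x`
has label `l x`. -/
structure IsSubsampleScheme {m : ℕ} {Δ : Type*} [MeasurableSpace Δ] {𝒵 : Type*} {ι : Type*}
    [DecidableEq ι] (A : Fin m → Δ → Set 𝒵) (l : ι → Fin m) (z : (ι → Δ) → Finset ι → 𝒵) :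
    Prop where
  /-- `z ω T` depends only on the restriction of `ω` to `T`. -/
  congr : ∀ T ω ω', (∀ x ∈ T, ω x = ω' x) → z ω T = z ω' T
  /-- Enlarging the sample keeps the decision exactly if it is confirmed by the new scenarios. -/
  eq_iff : ∀ ω T U, T ⊆ U → (z ω U = z ω T ↔ ∀ x ∈ U \ T, z ω T ∈ A (l x) (ω x))
  /-- Appropriateness is jointly measurable in the sample and a further scenario. -/
  measurable : ∀ T i, MeasurableSet {p : (ι → Δ) × Δ | z p.1 T ∈ A i p.2}

/-- The probability that `z` is appropriate for criterion `i`. -/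
noncomputable def appropriateness {m : ℕ} {Δ : Type*} [MeasurableSpace Δ] {𝒵 : Type*}
    (P : Measure Δ) (A : Fin m → Δ → Set 𝒵) (z : 𝒵) (i : Fin m) : ℝ :=
  P.real {δ | z ∈ A i δ}

/-! ### Irreducible subsamples and weak duality -/

section Subsample

variable {m : ℕ} {Δ : Type*} {𝒵 : Type*} {ι : Type*} [DecidableEq ι]

/-- Every scenario in `T` is a support scenario of the subsample `T`. -/
def Irreducible (z : (ι → Δ) → Finset ι → 𝒵) (T : Finset ι) (ω : ι → Δ) : Prop :=
  ∀ x ∈ T, z ω (T.erase x) ≠ z ω T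

open Classical in
/-- The support scenarios of the complete sample. -/
noncomputable def supportSet [Fintype ι] (z : (ι → Δ) → Finset ι → 𝒵) (ω : ι → Δ) : Finset ι :=
  Finset.univ.filter fun x => z ω (Finset.univ.erase x) ≠ z ω Finset.univ

variable [MeasurableSpace Δ] {A : Fin m → Δ → Set 𝒵} {l : ι → Fin m}
  {z : (ι → Δ) → Finset ι → 𝒵}

/-- A decision that is reproduced from a larger sample is reproduced from all samples between. -/
theorem IsSubsampleScheme.eq_of_between (hz : IsSubsampleScheme A l z) {ω : ι → Δ}
    {T U W : Finset ι} (hTU : T ⊆ U) (hUW : U ⊆ W) (h : z ω W = z ω T) : z ω U = z ω T := by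
  rw [hz.eq_iff ω T W (hTU.trans hUW)] at h
  rw [hz.eq_iff ω T U hTU]
  exact fun x hx => h x (Finset.sdiff_subset_sdiff hUW le_rfl hx)

/-- If `x` were redundant in the support set, the rest of that set would reproduce the full
decision, and so would the full sample without `x`. -/
theorem IsSubsampleScheme.irreducible_supportSet [Fintype ι] (hz : IsSubsampleScheme A l z)
    {ω : ι → Δ} (h : z ω (supportSet z ω) = z ω Finset.univ) :
    Irreducible z (supportSet z ω) ω := by
  intro x hx hex
  have hx' : z ω (Finset.univ.erase x) ≠ z ω Finset.univ := by
    simpa [supportSet] using hx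
  apply hx'
  have h1 : z ω Finset.univ = z ω ((supportSet z ω).erase x) := by rw [hex, h]
  rw [h1]
  exact hz.eq_of_between (Finset.erase_subset_erase x (Finset.subset_univ _))
    (Finset.subset_univ _) h1

/-- A reproducing `T` contains every support scenario, since one outside `T` could be dropped.
Conversely, an element of `T` outside the support set is redundant in `T`, because the support set
already reproduces the decision. -/
theorem IsSubsampleScheme.eq_supportSet [Fintype ι] (hz : IsSubsampleScheme A l z)
    {ω : ι → Δ} (h : z ω (supportSet z ω) = z ω Finset.univ) {T : Finset ι}
    (hT : Irreducible z T ω) (hTz : z ω Finset.univ = z ω T) : T = supportSet z ω := by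
  have hS : supportSet z ω ⊆ T := by
    intro x hx
    by_contra hxT
    have hx' : z ω (Finset.univ.erase x) ≠ z ω Finset.univ := by
      simpa [supportSet] using hx
    apply hx'
    rw [hTz]
    exact hz.eq_of_between (fun y hy => Finset.mem_erase.2
      ⟨fun hyx => hxT (hyx ▸ hy), Finset.mem_univ _⟩) (Finset.subset_univ _) hTz
  refine Finset.Subset.antisymm (fun x hx => ?_) hS
  by_contra hxS
  apply hT x hx
  rw [← hTz, ← h]
  exact hz.eq_of_between (fun y hy => Finset.mem_erase.2
    ⟨fun hyx => hxS (hyx ▸ hy), hS hy⟩) (Finset.subset_univ _) h.symm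

theorem IsSubsampleScheme.irreducible_congr (hz : IsSubsampleScheme A l z) {T : Finset ι}
    {ω ω' : ι → Δ} (h : ∀ x ∈ T, ω x = ω' x) : Irreducible z T ω ↔ Irreducible z T ω' := by
  unfold Irreducible
  refine forall₂_congr fun x hx => ?_
  rw [hz.congr T ω ω' h, hz.congr (T.erase x) ω ω' fun y hy => h y (Finset.mem_of_mem_erase hy)]

theorem IsSubsampleScheme.measurableSet_mem (hz : IsSubsampleScheme A l z) (T : Finset ι) (x : ι) :
    MeasurableSet {ω | z ω T ∈ A (l x) (ω x)} :=
  (measurable_id.prodMk (measurable_pi_apply x)) (hz.measurable T (l x))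

/-- The decision space carries no σ-algebra; equality of decisions is measurable because it amounts
to appropriateness for the added scenarios. -/
theorem IsSubsampleScheme.measurableSet_eq (hz : IsSubsampleScheme A l z) {T U : Finset ι}
    (hTU : T ⊆ U) : MeasurableSet {ω | z ω U = z ω T} := by
  simp_rw [hz.eq_iff _ T U hTU]
  have : {ω | ∀ x ∈ U \ T, z ω T ∈ A (l x) (ω x)} =
      ⋂ x ∈ U \ T, {ω | z ω T ∈ A (l x) (ω x)} := by ext; simp
  rw [this]
  exact Finset.measurableSet_biInter _ fun x _ => hz.measurableSet_mem T x

theorem IsSubsampleScheme.measurableSet_irreducible (hz : IsSubsampleScheme A l z)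
    (T : Finset ι) : MeasurableSet {ω | Irreducible z T ω} := by
  have : {ω | Irreducible z T ω} = ⋂ x ∈ T, {ω | z ω T = z ω (T.erase x)}ᶜ := by
    ext; simp [Irreducible, eq_comm]
  rw [this]
  exact Finset.measurableSet_biInter _ fun x _ =>
    (hz.measurableSet_eq (Finset.erase_subset x T)).compl

variable {P : Measure Δ} [IsProbabilityMeasure P]

theorem IsSubsampleScheme.measurable_measure (hz : IsSubsampleScheme A l z) (T : Finset ι)
    (i : Fin m) : Measurable fun ω => P {δ | z ω T ∈ A i δ} :=
  measurable_measure_prodMk_left (hz.measurable T i)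

theorem IsSubsampleScheme.measurable_appropriateness (hz : IsSubsampleScheme A l z)
    (T : Finset ι) (i : Fin m) : Measurable fun ω => appropriateness P A (z ω T) i :=
  (hz.measurable_measure T i).ennreal_toReal

theorem IsSubsampleScheme.measurableSet_pos (hz : IsSubsampleScheme A l z) (T : Finset ι) :
    MeasurableSet {ω | ∀ i, 0 < appropriateness P A (z ω T) i} := by
  have : {ω | ∀ i, 0 < appropriateness P A (z ω T) i} =
      ⋂ i, {ω | 0 < appropriateness P A (z ω T) i} := by ext; simp
  rw [this]
  exact MeasurableSet.iInter fun i =>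
    measurableSet_lt measurable_const (hz.measurable_appropriateness T i)

/-- Conditionally on the subsample `T`, the scenarios outside `T` are independent. -/
theorem IsSubsampleScheme.measure_inter_confirm [Fintype ι] (hz : IsSubsampleScheme A l z)
    {T U : Finset ι} (hTU : T ⊆ U) {B : Set (ι → Δ)} (hB : MeasurableSet B)
    (hBT : ∀ ω ω', (∀ x ∈ T, ω x = ω' x) → (ω ∈ B ↔ ω' ∈ B)) :
    Measure.pi (fun _ : ι => P) (B ∩ {ω | z ω U = z ω T}) =
      ∫⁻ ω in B, ∏ x ∈ U \ T, P {δ | z ω T ∈ A (l x) δ} ∂Measure.pi (fun _ : ι => P) := by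
  classical
  have hE := hz.measurableSet_eq hTU
  have hmeas : Measurable fun ω => ∏ x ∈ U \ T, P {δ | z ω T ∈ A (l x) δ} :=
    Finset.measurable_prod _ fun x _ => hz.measurable_measure T (l x)
  rw [← lintegral_indicator_one (hB.inter hE), ← lintegral_indicator hB]
  -- Fubini: freeze the coordinates in `T` and integrate out the others. The confirmation event is
  -- then a box `univ.pi S`.
  refine lintegral_eq_of_lmarginal_eq Tᶜ (measurable_const.indicator (hB.inter hE))
    (hmeas.indicator hB) ?_
  funext ω
  have hω : ∀ y : (i : (Tᶜ : Finset ι)) → Δ, ∀ x ∈ T,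
      Function.updateFinset ω Tᶜ y x = ω x := by
    intro y x hx
    simp [Function.updateFinset, hx]
  simp only [lmarginal]
  by_cases hωB : ω ∈ B
  · have h1 : ∀ y : (i : (Tᶜ : Finset ι)) → Δ, Function.updateFinset ω Tᶜ y ∈ B := fun y =>
      (hBT _ _ (hω y)).2 hωB
    have h2 : ∀ y : (i : (Tᶜ : Finset ι)) → Δ, z (Function.updateFinset ω Tᶜ y) T = z ω T :=
      fun y => hz.congr _ _ _ (hω y)
    set S : (Tᶜ : Finset ι) → Set Δ := fun x =>
      if (x : ι) ∈ U then {δ | z ω T ∈ A (l x) δ} else univ with hS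
    have hSm : ∀ x, MeasurableSet (S x) := by
      intro x
      simp only [hS]
      split_ifs
      · exact (measurable_const.prodMk measurable_id) (hz.measurable T (l x))
      · exact MeasurableSet.univ
    have h3 : ∀ y : (i : (Tᶜ : Finset ι)) → Δ,
        (B ∩ {ω | z ω U = z ω T}).indicator (1 : (ι → Δ) → ENNReal)
          (Function.updateFinset ω Tᶜ y) = (univ.pi S).indicator 1 y := by
      intro y
      have : Function.updateFinset ω Tᶜ y ∈ B ∩ {ω | z ω U = z ω T} ↔ y ∈ univ.pi S := by
        simp only [mem_inter_iff, h1 y, true_and, mem_ofPred_eq, hz.eq_iff _ T U hTU, h2,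
          mem_pi, mem_univ, forall_const, hS]
        constructor
        · intro h x
          split_ifs with hxU
          · have := h x (Finset.mem_sdiff.2 ⟨hxU, Finset.mem_compl.1 x.2⟩)
            simpa [Function.updateFinset, Finset.mem_compl.1 x.2] using this
          · trivial
        · intro h x hx
          rw [Finset.mem_sdiff] at hx
          have := h ⟨x, Finset.mem_compl.2 hx.2⟩
          simpa [Function.updateFinset, hx.1, hx.2] using this
      by_cases h : y ∈ univ.pi S
      · rw [indicator_of_mem h, indicator_of_mem (this.2 h)]; rfl
      · rw [indicator_of_notMem h, indicator_of_notMem (this.not.2 h)]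
    simp_rw [h3]
    rw [lintegral_indicator_one (MeasurableSet.univ_pi hSm), Measure.pi_pi]
    simp_rw [indicator_of_mem (h1 _), h2]
    rw [lintegral_const, measure_univ, mul_one]
    have h4 : ∀ x : (Tᶜ : Finset ι), P (S x) =
        (fun x => if x ∈ U then P {δ | z ω T ∈ A (l x) δ} else 1) (x : ι) := by
      intro x
      simp only [hS]
      split_ifs <;> simp
    simp_rw [h4]
    rw [Finset.prod_coe_sort Tᶜ (fun x => if x ∈ U then P {δ | z ω T ∈ A (l x) δ} else 1),
      ← Finset.prod_filter]
    refine Finset.prod_congr ?_ fun _ _ => rfl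
    ext x
    simp [and_comm]
  · have h1 : ∀ y : (i : (Tᶜ : Finset ι)) → Δ, Function.updateFinset ω Tᶜ y ∉ B := fun y =>
      (hBT _ _ (hω y)).not.2 hωB
    simp_rw [indicator_of_notMem (h1 _), indicator_of_notMem fun h : _ ∈ B ∩ _ => h1 _ h.1]

/-- The subsamples that are irreducible and reproduce the decision of a subsample `U` are unique,
as far as that decision can be confirmed. -/
theorem IsSubsampleScheme.ae_unique [Fintype ι] (hz : IsSubsampleScheme A l z)
    (hnd : ∀ᵐ ω ∂Measure.pi (fun _ : ι => P), z ω (supportSet z ω) = z ω Finset.univ)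
    {T T' U : Finset ι} (hT : T ⊆ U) (hT' : T' ⊆ U) (hne : T ≠ T') :
    Measure.pi (fun _ : ι => P) {ω | (Irreducible z T ω ∧ z ω U = z ω T) ∧
      (Irreducible z T' ω ∧ z ω U = z ω T') ∧ ∀ i, 0 < appropriateness P A (z ω U) i} = 0 := by
  set B := {ω | (Irreducible z T ω ∧ z ω U = z ω T) ∧
      (Irreducible z T' ω ∧ z ω U = z ω T') ∧ ∀ i, 0 < appropriateness P A (z ω U) i} with hBdef
  have hB : MeasurableSet B := by
    refine ((hz.measurableSet_irreducible T).inter (hz.measurableSet_eq hT)).inter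
      (((hz.measurableSet_irreducible T').inter (hz.measurableSet_eq hT')).inter
        (hz.measurableSet_pos U))
  have hBT : ∀ ω ω', (∀ x ∈ U, ω x = ω' x) → (ω ∈ B ↔ ω' ∈ B) := by
    intro ω ω' h
    simp only [hBdef, mem_ofPred_eq]
    rw [hz.irreducible_congr fun x hx => h x (hT hx), hz.irreducible_congr fun x hx => h x (hT' hx),
      hz.congr U ω ω' h, hz.congr T ω ω' fun x hx => h x (hT hx),
      hz.congr T' ω ω' fun x hx => h x (hT' hx)]
  -- Non-degeneracy of the full sample suffices: if the remaining scenarios confirm `z ω U`, both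
  -- `T` and `T'` must be the support set. On `B` this confirmation has positive conditional
  -- probability, so `B` itself is null.
  have hzero : Measure.pi (fun _ : ι => P) (B ∩ {ω | z ω Finset.univ = z ω U}) = 0 := by
    refine measure_mono_null (fun ω hω => ?_) (ae_iff.1 hnd)
    obtain ⟨⟨⟨h1, h2⟩, ⟨h3, h4⟩, -⟩, h5⟩ := hω
    intro h6
    have h5' : z ω Finset.univ = z ω U := h5
    exact hne ((hz.eq_supportSet h6 h1 (h5'.trans h2)).trans
      (hz.eq_supportSet h6 h3 (h5'.trans h4)).symm)
  have hmeas : Measurable fun ω => ∏ x ∈ Finset.univ \ U, P {δ | z ω U ∈ A (l x) δ} :=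
    Finset.measurable_prod _ fun x _ => hz.measurable_measure U (l x)
  rw [hz.measure_inter_confirm (Finset.subset_univ U) hB hBT, lintegral_eq_zero_iff hmeas,
    Filter.EventuallyEq, ae_restrict_iff' hB, ae_iff] at hzero
  refine measure_mono_null (fun ω hω => ?_) hzero
  simp only [mem_ofPred_eq, Classical.not_imp]
  refine ⟨hω, ?_⟩
  simp only [Pi.zero_apply, Finset.prod_eq_zero_iff, not_exists, not_and]
  intro x _ h0
  have := hω.2.2 (l x)
  simp [appropriateness, measureReal_def, h0] at this

/-- The primal constraint attached to `U`: the summands are probabilities of events that are almost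
surely disjoint by `ae_unique`. -/
theorem IsSubsampleScheme.sum_lintegral_le_one [Fintype ι] (hz : IsSubsampleScheme A l z)
    (hnd : ∀ᵐ ω ∂Measure.pi (fun _ : ι => P), z ω (supportSet z ω) = z ω Finset.univ)
    (U : Finset ι) :
    ∑ T ∈ U.powerset, ∫⁻ ω in {ω | Irreducible z T ω ∧ ∀ i, 0 < appropriateness P A (z ω T) i},
      ∏ x ∈ U \ T, P {δ | z ω T ∈ A (l x) δ} ∂Measure.pi (fun _ : ι => P) ≤ 1 := by
  have hB : ∀ T, MeasurableSet
      {ω | Irreducible z T ω ∧ ∀ i, 0 < appropriateness P A (z ω T) i} := fun T =>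
    (hz.measurableSet_irreducible T).inter (hz.measurableSet_pos T)
  calc _ = ∑ T ∈ U.powerset, Measure.pi (fun _ : ι => P)
        ({ω | Irreducible z T ω ∧ ∀ i, 0 < appropriateness P A (z ω T) i} ∩
          {ω | z ω U = z ω T}) := by
        refine Finset.sum_congr rfl fun T hT => ?_
        rw [hz.measure_inter_confirm (Finset.mem_powerset.1 hT) (hB T)]
        intro ω ω' h
        simp only [mem_ofPred_eq]
        rw [hz.irreducible_congr h, hz.congr T ω ω' h]
    _ = Measure.pi (fun _ : ι => P) (⋃ T ∈ U.powerset,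
        ({ω | Irreducible z T ω ∧ ∀ i, 0 < appropriateness P A (z ω T) i} ∩
          {ω | z ω U = z ω T})) := by
        rw [measure_biUnion_finset₀]
        · intro T hT T' hT' hne
          refine measure_mono_null (fun ω hω => ?_) (hz.ae_unique hnd
            (Finset.mem_powerset.1 hT) (Finset.mem_powerset.1 hT') hne)
          obtain ⟨⟨⟨h1, h2⟩, h3⟩, ⟨⟨h4, h5⟩, h6⟩⟩ := hω
          have h3' : z ω U = z ω T := h3
          exact ⟨⟨h1, h3⟩, ⟨h4, h6⟩, h3' ▸ h2⟩
        · exact fun T hT => ((hB T).inter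
            (hz.measurableSet_eq (Finset.mem_powerset.1 hT))).nullMeasurableSet
    _ ≤ 1 := prob_le_one

/-- Weak duality: weights `w` on the subsamples that dominate the confirmation probability on the
events `∏ i, P (z ∈ A i) < τ T` bound the probability that the event of the support set occurs. -/
theorem IsSubsampleScheme.measure_supportSet_le [Fintype ι] (hz : IsSubsampleScheme A l z)
    (hnd : ∀ᵐ ω ∂Measure.pi (fun _ : ι => P), z ω (supportSet z ω) = z ω Finset.univ)
    (τ : Finset ι → ℝ) (w : Finset ι → ENNReal)
    (hlab : ∀ T, 0 < τ T → ∀ i, ∃ x ∉ T, l x = i)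
    (hw : ∀ (T : Finset ι) (c : Fin m → ENNReal), (∀ i, 0 < c i ∧ c i ≤ 1) →
      ∏ i, (c i).toReal < τ T → ∏ x ∈ Finset.univ \ T, c (l x) ≤
        ∑ U with T ⊆ U, w U * ∏ x ∈ U \ T, c (l x)) :
    Measure.pi (fun _ : ι => P) {ω | ∏ i, appropriateness P A (z ω Finset.univ) i <
      τ (supportSet z ω)} ≤ ∑ U, w U := by
  set μ := Measure.pi (fun _ : ι => P) with hμ
  set g : Finset ι → Finset ι → (ι → Δ) → ENNReal := fun T U ω =>
    ∏ x ∈ U \ T, P {δ | z ω T ∈ A (l x) δ} with hg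
  have hgm : ∀ T U, Measurable (g T U) := fun T U =>
    Finset.measurable_prod _ fun x _ => hz.measurable_measure T (l x)
  set Q : Finset ι → Set (ι → Δ) := fun T =>
    {ω | Irreducible z T ω ∧ ∀ i, 0 < appropriateness P A (z ω T) i} with hQ
  set B : Finset ι → Set (ι → Δ) := fun T =>
    {ω | Irreducible z T ω ∧ ∏ i, appropriateness P A (z ω T) i < τ T} with hBdef
  have hB : ∀ T, MeasurableSet (B T) := fun T =>
    (hz.measurableSet_irreducible T).inter (measurableSet_lt
      (Finset.measurable_prod _ fun i _ => hz.measurable_appropriateness T i) measurable_const)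
  have hQm : ∀ T, MeasurableSet (Q T) := fun T =>
    (hz.measurableSet_irreducible T).inter (hz.measurableSet_pos T)
  have hcover : μ {ω | ∏ i, appropriateness P A (z ω Finset.univ) i < τ (supportSet z ω)} ≤
      ∑ T, μ (B T ∩ {ω | z ω Finset.univ = z ω T}) := by
    refine le_trans (measure_mono_ae ?_) (measure_biUnion_finset_le Finset.univ _)
    filter_upwards [hnd] with ω h hω
    refine mem_iUnion₂.2 ⟨supportSet z ω, Finset.mem_univ _,
      ⟨hz.irreducible_supportSet h, ?_⟩, h.symm⟩
    rw [h]
    exact hω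
  refine hcover.trans ?_
  calc ∑ T, μ (B T ∩ {ω | z ω Finset.univ = z ω T})
      = ∑ T, ∫⁻ ω in B T, g T Finset.univ ω ∂μ := by
        refine Finset.sum_congr rfl fun T _ => ?_
        rw [hz.measure_inter_confirm (Finset.subset_univ T) (hB T)]
        intro ω ω' h
        simp only [hBdef, mem_ofPred_eq]
        rw [hz.irreducible_congr h, hz.congr T ω ω' h]
    _ ≤ ∑ T, ∫⁻ ω in Q T, ∑ U with T ⊆ U, w U * g T U ω ∂μ := by
        refine Finset.sum_le_sum fun T _ => ?_
        rw [← lintegral_indicator (hB T), ← lintegral_indicator (hQm T)]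
        refine lintegral_mono fun ω => ?_
        by_cases hω : ω ∈ B T
        swap
        · rw [indicator_of_notMem hω]; exact zero_le
        rw [indicator_of_mem hω]
        by_cases hp : ∀ i, 0 < appropriateness P A (z ω T) i
        · rw [indicator_of_mem (show ω ∈ Q T from ⟨hω.1, hp⟩)]
          refine hw T (fun i => P {δ | z ω T ∈ A i δ}) (fun i => ⟨?_, prob_le_one⟩) hω.2
          exact (ENNReal.toReal_pos_iff.1 (hp i)).1
        -- If some criterion is almost never satisfied, `hlab` gives a scenario of that label
        -- outside `T`, whose factor makes the confirmation probability vanish.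
        · push Not at hp
          obtain ⟨i, hi⟩ := hp
          have h0 : appropriateness P A (z ω T) i = 0 := le_antisymm hi measureReal_nonneg
          have hτ : 0 < τ T := lt_of_le_of_lt
            (Finset.prod_nonneg fun i _ => measureReal_nonneg) hω.2
          obtain ⟨x, hx, rfl⟩ := hlab T hτ i
          have : g T Finset.univ ω = 0 := by
            refine Finset.prod_eq_zero (i := x) (by simpa using hx) ?_
            exact (measureReal_eq_zero_iff).1 h0
          rw [this]; exact zero_le
    _ = ∑ T, ∑ U with T ⊆ U, w U * ∫⁻ ω in Q T, g T U ω ∂μ := by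
        refine Finset.sum_congr rfl fun T _ => ?_
        rw [lintegral_finsetSum _ fun U _ => (hgm T U).const_mul _]
        exact Finset.sum_congr rfl fun U _ => lintegral_const_mul _ (hgm T U)
    -- Exchanging the sums leaves the primal constraint of each `U`, weighted by `w U`.
    _ = ∑ U, w U * ∑ T ∈ U.powerset, ∫⁻ ω in Q T, g T U ω ∂μ := by
        simp_rw [Finset.mul_sum]
        refine Finset.sum_comm' fun T U => ?_
        simp
    _ ≤ ∑ U, w U := Finset.sum_le_sum fun U _ =>
        mul_le_of_le_one_right zero_le (hz.sum_lintegral_le_one hnd U)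

end Subsample

/-! ### The function `ψ`, its zero, and the passage from joint risk to products -/

section Psi

variable {m : ℕ}

/-- The largest number by which all dataset sizes can be reduced simultaneously while staying at
least `k`. -/
noncomputable def gap (k N : Fin m → ℕ) : ℕ := ⨅ i, (N i - k i)

theorem gap_le (k N : Fin m → ℕ) (i : Fin m) : gap k N ≤ N i - k i :=
  ciInf_le (OrderBot.bddBelow _) i

theorem exists_eq_gap (hm : 1 ≤ m) (k N : Fin m → ℕ) : ∃ i, N i - k i = gap k N := by
  have : Nonempty (Fin m) := ⟨⟨0, hm⟩⟩
  exact Nat.sInf_mem (range_nonempty fun i => N i - k i)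

theorem indexRange_self (hm : 1 ≤ m) {k N : Fin m → ℕ} (hk : ∀ i, k i ≤ N i) :
    indexRange k N N = Finset.Icc (-(gap k N : ℤ)) 0 := by
  have : Nonempty (Fin m) := ⟨⟨0, hm⟩⟩
  have h1 : (⨆ i, ((k i : ℤ) - (N i : ℤ))) = -(gap k N : ℤ) := by
    apply le_antisymm
    · refine ciSup_le fun i => ?_
      have := gap_le k N i
      have := hk i
      omega
    · obtain ⟨i, hi⟩ := exists_eq_gap hm k N
      refine le_ciSup_of_le (Finite.bddAbove_range _) i ?_
      have := hk i
      omega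
  unfold indexRange
  simp [h1]

theorem sum_indexRange_erase (hm : 1 ≤ m) {k N : Fin m → ℕ} (hk : ∀ i, k i ≤ N i) (f : ℤ → ℝ) :
    ∑ j ∈ (indexRange k N N).erase 0, f j = ∑ j ∈ Finset.Icc 1 (gap k N), f (-(j : ℤ)) := by
  rw [indexRange_self hm hk]
  symm
  refine Finset.sum_bij (fun j _ => -(j : ℤ)) ?_ ?_ ?_ fun _ _ => rfl
  · intro j hj
    simp only [Finset.mem_Icc, Finset.mem_erase] at hj ⊢
    omega
  · intro a _ b _ h
    simpa using h
  · intro b hb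
    simp only [Finset.mem_Icc, Finset.mem_erase] at hb
    exact ⟨(-b).toNat, by simp only [Finset.mem_Icc]; omega, by omega⟩

/-- The ratio of the multi-index binomials `binom(N - j 𝟏, k)` and `binom(N, k)`. -/
noncomputable def chooseRatio (k N : Fin m → ℕ) (j : ℕ) : ℝ :=
  ∏ i, ((N i - j).choose (k i) : ℝ) / ((N i).choose (k i) : ℝ)

/-- For `H = N` every exponent is negative, so `ψ` is 1 minus a nonnegative combination of powers of
`1 / t`, and the normalization `|𝒥_0| - 1` equals `min N_i`. -/
theorem psi_self (hm : 1 ≤ m) (β : ℝ) {k N : Fin m → ℕ} (hk : ∀ i, k i ≤ N i) (t : ℝ) :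
    psi β k N N t =
      1 - β / (gap 0 N : ℝ) * ∑ j ∈ Finset.Icc 1 (gap k N), chooseRatio k N j * (t ^ j)⁻¹ := by
  have hcard : ((indexRange 0 N N).card : ℝ) - 1 = (gap 0 N : ℝ) := by
    rw [indexRange_self hm fun i => by simp, Int.card_Icc,
      show (0 + 1 - -(gap 0 N : ℤ)).toNat = gap 0 N + 1 by omega]
    push_cast
    ring
  unfold psi
  rw [hcard, sum_indexRange_erase hm hk]
  congr 2
  refine Finset.sum_congr rfl fun j _ => ?_
  rw [zpow_neg, zpow_natCast]
  congr 1
  simp only [shiftedChoose, chooseRatio, Nat.cast_prod, Finset.prod_div_distrib]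
  congr 1
  refine Finset.prod_congr rfl fun i _ => ?_
  congr 2
  omega

/-- Raising `j` by one multiplies the ratio by `(N - j - k) / (N - j)`, which is at most `(N - k) /
N`. -/
theorem choose_ratio_le {k N j : ℕ} (h : j + k ≤ N) (hN : k < N) :
    ((N - j).choose k : ℝ) / (N.choose k : ℝ) ≤ (1 - (k : ℝ) / N) ^ j := by
  have hNpos : (0 : ℝ) < N := by exact_mod_cast (Nat.zero_le k).trans_lt hN
  have hc : (0 : ℝ) < N.choose k := by exact_mod_cast Nat.choose_pos hN.le
  induction j with
  | zero => simp [hc.ne']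
  | succ j ih =>
    have ih := ih (by omega)
    have key := Nat.choose_mul_succ_eq (N - (j + 1)) k
    rw [show N - (j + 1) + 1 = N - j by omega] at key
    have key' : ((N - (j + 1)).choose k : ℝ) * (N - j) = (N - j).choose k * (N - j - k) := by
      have h1 : ((N - j : ℕ) : ℝ) = (N : ℝ) - j := by rw [Nat.cast_sub (by omega)]
      have h2 : ((N - j - k : ℕ) : ℝ) = (N : ℝ) - j - k := by
        rw [Nat.cast_sub (by omega), h1]
      rw [← h2, ← h1]
      exact_mod_cast key
    have hjN : (j : ℝ) + 1 ≤ N := by exact_mod_cast (by omega : j + 1 ≤ N)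
    have hpos : (0 : ℝ) < (N : ℝ) - j := by linarith
    have hkN : (k : ℝ) ≤ N := by exact_mod_cast hN.le
    have hstep : ((N : ℝ) - j - k) / (N - j) ≤ 1 - (k : ℝ) / N := by
      rw [div_le_iff₀ hpos]
      have : (1 - (k : ℝ) / N) * (N - j) = N - j - k + k * j / N := by field_simp; ring
      rw [this]
      have : (0 : ℝ) ≤ k * j / N := by positivity
      linarith
    have h0 : (0 : ℝ) ≤ 1 - (k : ℝ) / N := by
      rw [sub_nonneg, div_le_one hNpos]; exact hkN
    have heq : ((N - (j + 1)).choose k : ℝ) / (N.choose k : ℝ) =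
        ((N - j).choose k : ℝ) / (N.choose k : ℝ) * (((N : ℝ) - j - k) / (N - j)) := by
      field_simp
      linarith [key']
    rw [heq, pow_succ]
    have h3 : (0 : ℝ) ≤ ((N : ℝ) - j - k) / (N - j) := by
      apply div_nonneg _ hpos.le
      have : (j : ℝ) + k ≤ N := by exact_mod_cast (by omega : j + k ≤ N)
      linarith
    exact mul_le_mul ih hstep h3 (pow_nonneg h0 j)

theorem chooseRatio_pos {k N : Fin m → ℕ} (hk : ∀ i, k i ≤ N i) {j : ℕ} (hj : j ≤ gap k N) :
    0 < chooseRatio k N j := by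
  refine Finset.prod_pos fun i _ => div_pos ?_ ?_
  · have := gap_le k N i
    have := hk i
    exact_mod_cast Nat.choose_pos (by omega)
  · exact_mod_cast Nat.choose_pos (hk i)

theorem tHat_pos {k N : Fin m → ℕ} (hk : ∀ i, k i < N i) : 0 < tHat k N := by
  refine Finset.prod_pos fun i _ => ?_
  have hNpos : (0 : ℝ) < N i := by exact_mod_cast (Nat.zero_le _).trans_lt (hk i)
  rw [sub_pos, div_lt_one hNpos]
  exact_mod_cast hk i

theorem chooseRatio_le_tHat_pow {k N : Fin m → ℕ} (hk : ∀ i, k i < N i) {j : ℕ}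
    (hj : j ≤ gap k N) : chooseRatio k N j ≤ tHat k N ^ j := by
  unfold chooseRatio tHat
  rw [← Finset.prod_pow]
  refine Finset.prod_le_prod (fun i _ => by positivity) fun i _ => choose_ratio_le ?_ (hk i)
  have := gap_le k N i
  have := hk i
  omega

theorem gap_pos (hm : 1 ≤ m) {k N : Fin m → ℕ} (hk : ∀ i, k i < N i) : 0 < gap k N := by
  obtain ⟨i, hi⟩ := exists_eq_gap hm k N
  have := hk i
  omega

theorem gap_le_gap_zero (hm : 1 ≤ m) (k N : Fin m → ℕ) : gap k N ≤ gap 0 N := by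
  obtain ⟨i, hi⟩ := exists_eq_gap hm 0 N
  have := gap_le k N i
  simp at hi
  omega

theorem psi_strictMonoOn (hm : 1 ≤ m) {β : ℝ} (hβ : 0 < β) {k N : Fin m → ℕ}
    (hk : ∀ i, k i < N i) : StrictMonoOn (psi β k N N) (Ioi 0) := by
  intro s hs t _ hst
  have hs0 : 0 < s := hs
  have hg := gap_pos hm hk
  rw [psi_self hm β (fun i => (hk i).le), psi_self hm β (fun i => (hk i).le)]
  have hn : (0 : ℝ) < gap 0 N := by exact_mod_cast hg.trans_le (gap_le_gap_zero hm k N)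
  refine sub_lt_sub_left (mul_lt_mul_of_pos_left (Finset.sum_lt_sum_of_nonempty
    ⟨1, by simp only [Finset.mem_Icc]; omega⟩ fun j hj => ?_) (div_pos hβ hn)) 1
  rw [Finset.mem_Icc] at hj
  refine mul_lt_mul_of_pos_left ?_ (chooseRatio_pos (fun i => (hk i).le) hj.2)
  exact inv_strictAnti₀ (pow_pos hs0 j) (pow_lt_pow_left₀ hst hs0.le (by omega))

/-- The function `ψ_{k,N,N}` has exactly one zero in `(0, t̂)`. -/
theorem existsUnique_psi_eq_zero (hm : 1 ≤ m) {β : ℝ} (hβ : β ∈ Ioo (0 : ℝ) 1)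
    {k N : Fin m → ℕ} (hk : ∀ i, k i < N i) :
    ∃! t : ℝ, t ∈ Ioo 0 (tHat k N) ∧ psi β k N N t = 0 := by
  have hk' : ∀ i, k i ≤ N i := fun i => (hk i).le
  have hg := gap_pos hm hk
  have hT := tHat_pos hk
  have hn : (0 : ℝ) < gap 0 N := by exact_mod_cast hg.trans_le (gap_le_gap_zero hm k N)
  have hmono := psi_strictMonoOn hm hβ.1 hk
  -- At `t̂` each of the at most `gap 0 N` summands is at most 1, so `ψ(t̂) ≥ 1 - β`.
  have hright : 0 < psi β k N N (tHat k N) := by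
    rw [psi_self hm β hk', sub_pos]
    have h1 : ∑ j ∈ Finset.Icc 1 (gap k N), chooseRatio k N j * (tHat k N ^ j)⁻¹ ≤ gap 0 N := by
      calc _ ≤ ∑ j ∈ Finset.Icc 1 (gap k N), (1 : ℝ) := by
            refine Finset.sum_le_sum fun j hj => ?_
            rw [← div_eq_mul_inv, div_le_one (pow_pos hT j)]
            exact chooseRatio_le_tHat_pow hk (Finset.mem_Icc.1 hj).2
        _ ≤ gap 0 N := by simpa using gap_le_gap_zero hm k N
    calc _ ≤ β / gap 0 N * gap 0 N := mul_le_mul_of_nonneg_left h1 (div_pos hβ.1 hn).le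
      _ = β := by field_simp
      _ < 1 := hβ.2
  -- `r` is the coefficient of `1 / t`; for `t < r` the term `j = 1` alone exceeds 1.
  set r := β / gap 0 N * chooseRatio k N 1 with hr
  have hrpos : 0 < r := mul_pos (div_pos hβ.1 hn) (chooseRatio_pos hk' hg)
  set s := min (tHat k N) r / 2 with hs
  have hs0 : 0 < s := half_pos (lt_min hT hrpos)
  have hsT : s < tHat k N := (half_lt_self (lt_min hT hrpos)).trans_le (min_le_left _ _)
  have hsr : s < r := (half_lt_self (lt_min hT hrpos)).trans_le (min_le_right _ _)
  have hleft : psi β k N N s < 0 := by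
    rw [psi_self hm β hk', sub_neg]
    have h1 : chooseRatio k N 1 * (s ^ 1)⁻¹ ≤
        ∑ j ∈ Finset.Icc 1 (gap k N), chooseRatio k N j * (s ^ j)⁻¹ := by
      refine Finset.single_le_sum (f := fun j => chooseRatio k N j * (s ^ j)⁻¹)
        (fun j hj => ?_) (by simp only [Finset.mem_Icc]; omega)
      exact mul_nonneg (chooseRatio_pos hk' (Finset.mem_Icc.1 hj).2).le (by positivity)
    calc 1 < r / s := (one_lt_div hs0).2 hsr
      _ = β / gap 0 N * (chooseRatio k N 1 * (s ^ 1)⁻¹) := by rw [hr, pow_one]; ring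
      _ ≤ _ := mul_le_mul_of_nonneg_left h1 (div_pos hβ.1 hn).le
  have hcont : ContinuousOn (psi β k N N) (Icc s (tHat k N)) := by
    rw [continuousOn_congr fun t _ => psi_self hm β hk' t]
    refine continuousOn_const.sub (continuousOn_const.mul (continuousOn_finsetSum _ fun j _ =>
      continuousOn_const.mul ((continuousOn_pow j).inv₀ fun t ht => ?_)))
    exact (pow_pos (hs0.trans_le ht.1) j).ne'
  obtain ⟨t, ht, ht0⟩ := intermediate_value_Ioo hsT.le hcont ⟨hleft, hright⟩
  refine ⟨t, ⟨⟨hs0.trans ht.1, ht.2⟩, ht0⟩, fun y hy => ?_⟩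
  exact hmono.injOn hy.1.1 (hs0.trans ht.1) (hy.2.trans ht0.symm)

/-- The default value 0 of `tBar` excludes exhausted labels: a positive threshold leaves a scenario
of each label outside the support set. -/
theorem lt_of_tBar_pos {β : ℝ} {k N : Fin m → ℕ} (h : 0 < tBar β k N N) (i : Fin m) :
    k i < N i := by
  unfold tBar at h
  split_ifs at h with h'
  · exact h' i
  · exact absurd h (lt_irrefl _)

theorem psi_neg_of_lt_tBar (hm : 1 ≤ m) {β : ℝ} (hβ : β ∈ Ioo (0 : ℝ) 1) {k N : Fin m → ℕ}
    {t : ℝ} (ht : 0 < t) (h : t < tBar β k N N) : psi β k N N t < 0 := by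
  have hk : ∀ i, k i < N i := lt_of_tBar_pos (ht.trans h)
  obtain ⟨t₀, ⟨h1, h2⟩, h3⟩ := existsUnique_psi_eq_zero hm hβ hk
  have hset : {t | t ∈ Ioo 0 (tHat k N) ∧ psi β k N N t = 0} = {t₀} :=
    Set.ext fun y => ⟨fun hy => h3 y hy, fun hy => by rw [mem_singleton_iff.1 hy]; exact ⟨h1, h2⟩⟩
  rw [tBar, if_pos hk, hset, csInf_singleton] at h
  exact h2 ▸ psi_strictMonoOn hm hβ.1 hk ht h1.1 h

theorem tBar_nonneg (β : ℝ) (k N : Fin m → ℕ) : 0 ≤ tBar β k N N := by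
  unfold tBar
  split_ifs
  · exact Real.sInf_nonneg fun t ht => ht.1.1.le
  · exact le_rfl

/-- A joint failure probability beyond `ε̄(k)` forces the product of the probabilities of success
for the single criteria below `t̄_k`. -/
theorem prod_lt_tBar (hm : 1 ≤ m) {β : ℝ} {k N : Fin m → ℕ} {a : Fin m → ℝ} {V : ℝ}
    (ha : ∀ i, 0 ≤ a i) (hV1 : V ≤ 1) (hV : V ≤ ∑ i, (1 - a i)) (h : epsBar β N k < V) :
    ∏ i, a i < tBar β k N N := by
  have hm0 : (0 : ℝ) < m := by exact_mod_cast hm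
  -- The cap at 1 cannot be the active term, since `V ≤ 1`.
  have h1 : (m : ℝ) * (1 - tBar β k N N ^ (1 / (m : ℝ))) < V := by
    rcases min_lt_iff.1 h with h | h
    · exact h
    · exact absurd h hV1.not_gt
  have h2 : (∑ i, a i) / m < tBar β k N N ^ (1 / (m : ℝ)) := by
    rw [div_lt_iff₀ hm0]
    simp only [Finset.sum_sub_distrib, Finset.sum_const, Finset.card_univ, Fintype.card_fin,
      nsmul_eq_mul, mul_one] at hV
    nlinarith
  -- AM-GM with unit weights bounds the `m`-th root of `∏ a i` by the mean in `h2`.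
  have h3 := Real.geom_mean_le_arith_mean Finset.univ (fun _ : Fin m => (1 : ℝ)) a
    (fun _ _ => zero_le_one) (by simpa using Nat.lt_of_lt_of_le zero_lt_one hm) (fun i _ => ha i)
  simp only [Real.rpow_one, Finset.sum_const, Finset.card_univ, Fintype.card_fin, nsmul_eq_mul,
    mul_one, one_mul] at h3
  rw [one_div] at h2
  exact (Real.rpow_lt_rpow_iff (Finset.prod_nonneg fun i _ => ha i) (tBar_nonneg β k N)
    (inv_pos.2 hm0)).1 (h3.trans_lt h2)

end Psi

/-! ### Counting subsamples by label and the dual weights -/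

section Counting

variable {m : ℕ} {N : Fin m → ℕ}

/-- The elements of `T` with label `i`. -/
def slice (T : Finset (Σ i, Fin (N i))) (i : Fin m) : Finset (Fin (N i)) :=
  Finset.univ.filter fun a => ⟨i, a⟩ ∈ T

@[simp] theorem mem_slice {T : Finset (Σ i, Fin (N i))} {i : Fin m} {a : Fin (N i)} :
    a ∈ slice T i ↔ ⟨i, a⟩ ∈ T := by simp [slice]

theorem sigma_slice (T : Finset (Σ i, Fin (N i))) : Finset.univ.sigma (slice T) = T := by
  ext ⟨i, a⟩; simp

theorem slice_univ (i : Fin m) : slice (Finset.univ : Finset (Σ i, Fin (N i))) i = Finset.univ := by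
  ext; simp

theorem slice_sdiff (U T : Finset (Σ i, Fin (N i))) (i : Fin m) :
    slice (U \ T) i = slice U i \ slice T i := by
  ext a; simp

theorem slice_subset_slice {U T : Finset (Σ i, Fin (N i))} (h : T ⊆ U) (i : Fin m) :
    slice T i ⊆ slice U i := fun a ha => by
  rw [mem_slice] at ha ⊢; exact h ha

theorem card_slice_le (T : Finset (Σ i, Fin (N i))) (i : Fin m) : (slice T i).card ≤ N i := by
  simpa using Finset.card_le_univ (slice T i)

theorem prod_sdiff_label {R : Type*} [CommMonoid R] (c : Fin m → R)
    {T U : Finset (Σ i, Fin (N i))} (h : T ⊆ U) :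
    ∏ x ∈ U \ T, c x.1 = ∏ i, c i ^ ((slice U i).card - (slice T i).card) := by
  rw [← sigma_slice (U \ T), Finset.prod_sigma]
  refine Finset.prod_congr rfl fun i _ => ?_
  simp only [Finset.prod_const]
  rw [slice_sdiff, Finset.card_sdiff_of_subset (slice_subset_slice h i)]

/-- The sets that contain all but `j` of the elements of each label. -/
def coSized (N : Fin m → ℕ) (j : ℕ) : Finset (Finset (Σ i, Fin (N i))) :=
  Finset.univ.filter fun U => ∀ i, (slice U i).card = N i - j

/-- The slices of `U` can be chosen independently, one label at a time. The bound on `j` keeps all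
the subtractions untruncated. -/
theorem card_coSized_filter (T : Finset (Σ i, Fin (N i))) {j : ℕ}
    (hj : j ≤ gap (fun i => (slice T i).card) N) :
    ((coSized N j).filter fun U => T ⊆ U).card =
      ∏ i, (N i - (slice T i).card).choose (N i - j - (slice T i).card) := by
  have h1 : ((coSized N j).filter fun U => T ⊆ U).card = (Fintype.piFinset fun i =>
      (Finset.powersetCard (N i - j) Finset.univ).filter fun V => slice T i ⊆ V).card := by
    refine Finset.card_bij (fun U _ => slice U) ?_ ?_ ?_
    · intro U hU
      simp only [coSized, Finset.mem_filter, Finset.mem_univ, true_and] at hU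
      simp only [Fintype.mem_piFinset, Finset.mem_filter, Finset.mem_powersetCard,
        Finset.subset_univ, true_and]
      exact fun i => ⟨hU.1 i, slice_subset_slice hU.2 i⟩
    · intro U _ U' _ h
      rw [← sigma_slice U, ← sigma_slice U']
      exact congrArg _ h
    · intro V hV
      simp only [Fintype.mem_piFinset, Finset.mem_filter, Finset.mem_powersetCard,
        Finset.subset_univ, true_and] at hV
      have hs : slice (Finset.univ.sigma V) = V := by
        funext i; ext a; simp
      refine ⟨Finset.univ.sigma V, ?_, hs⟩
      simp only [coSized, Finset.mem_filter, Finset.mem_univ, true_and, hs]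
      refine ⟨fun i => (hV i).1, ?_⟩
      rw [← sigma_slice T]
      exact Finset.sigma_mono le_rfl fun i => (hV i).2
  rw [h1, Fintype.card_piFinset]
  refine Finset.prod_congr rfl fun i _ => ?_
  have := gap_le (fun i => (slice T i).card) N i
  have := card_slice_le T i
  rw [Finset.card_filter_powersetCard_subset _ _ _ (Finset.subset_univ _) (by omega)]
  simp

theorem card_coSized {j : ℕ} (hj : j ≤ gap 0 N) :
    (coSized N j).card = ∏ i, (N i).choose (N i - j) := by
  have h0 : ∀ i, (slice (∅ : Finset (Σ i, Fin (N i))) i).card = 0 := by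
    intro i; simp [slice]
  have := card_coSized_filter (∅ : Finset (Σ i, Fin (N i))) (j := j) (by simp only [h0]; exact hj)
  simpa [h0] using this

/-- The proportion, among the sets that miss `j` elements of each label, of those that contain
`T`. -/
theorem card_coSized_ratio (hm : 1 ≤ m) (T : Finset (Σ i, Fin (N i))) {j : ℕ}
    (hj : j ≤ gap (fun i => (slice T i).card) N) :
    (((coSized N j).filter fun U => T ⊆ U).card : ℝ) / (coSized N j).card =
      chooseRatio (fun i => (slice T i).card) N j := by
  rw [card_coSized_filter T hj, card_coSized (hj.trans (gap_le_gap_zero hm _ N)), chooseRatio,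
    Nat.cast_prod, Nat.cast_prod, ← Finset.prod_div_distrib]
  refine Finset.prod_congr rfl fun i _ => ?_
  have h1 := gap_le (fun i => (slice T i).card) N i
  have h2 := card_slice_le T i
  have hj1 : (slice T i).card ≤ N i - j := by omega
  generalize (slice T i).card = k at h2 hj1 ⊢
  generalize N i = n at h2 hj1 ⊢
  have h3 : (0 : ℝ) < (n.choose (n - j) : ℝ) := by exact_mod_cast Nat.choose_pos (by omega)
  have h4 : (0 : ℝ) < (n.choose k : ℝ) := by exact_mod_cast Nat.choose_pos h2
  rw [div_eq_div_iff h3.ne' h4.ne']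
  -- Trinomial revision: `C(n, n-j) C(n-j, k) = C(n, k) C(n-k, n-j-k)`.
  have := Nat.choose_mul (n := n) (k := n - j) (s := k) hj1
  norm_cast
  linarith

/-- The weights of the weak duality argument: mass `β / n` spread uniformly on the sets that miss
`j` elements of each label, for `j = 1, …, n = min N`. -/
noncomputable def dualWeight (β : ℝ) (U : Finset (Σ i, Fin (N i))) : ℝ :=
  ∑ j ∈ Finset.Icc 1 (gap 0 N), if U ∈ coSized N j then β / gap 0 N / (coSized N j).card else 0

theorem dualWeight_nonneg {β : ℝ} (hβ : 0 ≤ β) (U : Finset (Σ i, Fin (N i))) :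
    0 ≤ dualWeight β U :=
  Finset.sum_nonneg fun j _ => by split_ifs <;> positivity

theorem card_coSized_pos {j : ℕ} (hj : j ≤ gap 0 N) : 0 < (coSized N j).card := by
  rw [card_coSized hj]
  exact Finset.prod_pos fun i _ => Nat.choose_pos (Nat.sub_le _ _)

theorem sum_dualWeight (hm : 1 ≤ m) (hN : ∀ i, 1 ≤ N i) (β : ℝ) :
    ∑ U : Finset (Σ i, Fin (N i)), dualWeight β U = β := by
  have hn : (0 : ℝ) < gap 0 N := by exact_mod_cast gap_pos hm (k := 0) (fun i => hN i)
  unfold dualWeight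
  rw [Finset.sum_comm]
  calc _ = ∑ j ∈ Finset.Icc 1 (gap 0 N), β / gap 0 N := by
        refine Finset.sum_congr rfl fun j hj => ?_
        have : (0 : ℝ) < (coSized N j).card := by
          exact_mod_cast card_coSized_pos (Finset.mem_Icc.1 hj).2
        rw [← Finset.sum_filter, Finset.sum_const, Finset.filter_mem_eq_inter, Finset.univ_inter,
          nsmul_eq_mul]
        field_simp
    _ = β := by
        rw [Finset.sum_const, Nat.card_Icc, nsmul_eq_mul, Nat.add_sub_cancel]
        field_simp

/-- Dual feasibility. If `U ⊇ T` misses `j` elements of each label, its confirmation product is `W /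
p ^ j`, and `chooseRatio` is the proportion of such `U` containing `T`. The right side is thus at
least `W (1 - ψ(p)) ≥ W`. -/
theorem le_sum_dualWeight (hm : 1 ≤ m) {β : ℝ} (hβ : β ∈ Ioo (0 : ℝ) 1)
    (T : Finset (Σ i, Fin (N i))) {a : Fin m → ℝ} (ha : ∀ i, 0 < a i)
    (h : ∏ i, a i < tBar β (fun i => (slice T i).card) N N) :
    ∏ x ∈ Finset.univ \ T, a x.1 ≤ ∑ U with T ⊆ U, dualWeight β U * ∏ x ∈ U \ T, a x.1 := by
  set k : Fin m → ℕ := fun i => (slice T i).card with hk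
  have hkN : ∀ i, k i ≤ N i := card_slice_le T
  have hp : 0 < ∏ i, a i := Finset.prod_pos fun i _ => ha i
  set p := ∏ i, a i with hpdef
  have hpsi := (psi_neg_of_lt_tBar hm hβ hp h).le
  rw [psi_self hm β hkN, sub_nonpos] at hpsi
  set W := ∏ i, a i ^ (N i - k i) with hW
  have hWpos : 0 < W := Finset.prod_pos fun i _ => pow_pos (ha i) _
  have hL : ∏ x ∈ Finset.univ \ T, a x.1 = W := by
    rw [prod_sdiff_label a (Finset.subset_univ T)]
    refine Finset.prod_congr rfl fun i _ => ?_
    rw [slice_univ, Finset.card_univ, Fintype.card_fin]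
  have hterm : ∀ j ≤ gap k N, ∀ U ∈ coSized N j, T ⊆ U →
      ∏ x ∈ U \ T, a x.1 = W * (p ^ j)⁻¹ := by
    intro j hj U hU hTU
    rw [prod_sdiff_label a hTU, ← div_eq_mul_inv, eq_div_iff (pow_pos hp j).ne', hpdef,
      ← Finset.prod_pow, ← Finset.prod_mul_distrib]
    refine Finset.prod_congr rfl fun i _ => ?_
    rw [← pow_add, (Finset.mem_filter.1 hU).2 i]
    congr 1
    have := gap_le k N i
    have := hkN i
    change N i - j - k i + j = N i - k i
    omega
  rw [hL]
  calc W ≤ W * (β / gap 0 N * ∑ j ∈ Finset.Icc 1 (gap k N), chooseRatio k N j * (p ^ j)⁻¹) :=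
        le_mul_of_one_le_right hWpos.le hpsi
    _ = ∑ j ∈ Finset.Icc 1 (gap k N), ∑ U with T ⊆ U,
          (if U ∈ coSized N j then β / gap 0 N / (coSized N j).card else 0) *
            ∏ x ∈ U \ T, a x.1 := by
        rw [Finset.mul_sum, Finset.mul_sum]
        refine Finset.sum_congr rfl fun j hj => ?_
        have hj' := (Finset.mem_Icc.1 hj).2
        simp_rw [ite_mul, zero_mul]
        rw [← Finset.sum_filter, Finset.filter_filter, ← card_coSized_ratio hm T hj']
        have hfil : Finset.univ.filter (fun U => T ⊆ U ∧ U ∈ coSized N j) =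
            (coSized N j).filter fun U => T ⊆ U := by ext; simp [and_comm]
        rw [hfil, Finset.sum_congr rfl fun U hU => by
          rw [hterm j hj' U (Finset.mem_filter.1 hU).1 (Finset.mem_filter.1 hU).2],
          Finset.sum_const, nsmul_eq_mul]
        ring
    _ ≤ ∑ j ∈ Finset.Icc 1 (gap 0 N), ∑ U with T ⊆ U,
          (if U ∈ coSized N j then β / gap 0 N / (coSized N j).card else 0) *
            ∏ x ∈ U \ T, a x.1 := by
        refine Finset.sum_le_sum_of_subset_of_nonneg
          (Finset.Icc_subset_Icc_right (gap_le_gap_zero hm k N)) fun j _ _ => ?_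
        refine Finset.sum_nonneg fun U _ => mul_nonneg ?_
          (Finset.prod_nonneg fun x _ => (ha x.1).le)
        have := hβ.1.le
        split_ifs <;> positivity
    _ = _ := by
        rw [Finset.sum_comm]
        exact Finset.sum_congr rfl fun U _ => by rw [dualWeight, Finset.sum_mul]

end Counting

/-! ### From lists to subsamples -/

section Subdata

variable {m : ℕ} {Δ : Type*} {𝒵 : Type*} {N : Fin m → ℕ}

/-- The scenarios of label `i` in the subsample `T`. -/
def subData (ω : (Σ i, Fin (N i)) → Δ) (T : Finset (Σ i, Fin (N i))) (i : Fin m) : Multiset Δ :=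
  (slice T i).val.map fun a => ω ⟨i, a⟩

/-- The decision made from the subsample `T`. -/
noncomputable def subDecision (M : (Fin m → List Δ) → 𝒵) (ω : (Σ i, Fin (N i)) → Δ)
    (T : Finset (Σ i, Fin (N i))) : 𝒵 :=
  M fun i => (subData ω T i).toList

theorem subData_congr {ω ω' : (Σ i, Fin (N i)) → Δ} {T : Finset (Σ i, Fin (N i))}
    (h : ∀ x ∈ T, ω x = ω' x) : subData ω T = subData ω' T := by
  funext i
  exact Multiset.map_congr rfl fun a ha => h _ (mem_slice.1 ha)

theorem subData_add_sdiff (ω : (Σ i, Fin (N i)) → Δ) {T U : Finset (Σ i, Fin (N i))}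
    (h : T ⊆ U) (i : Fin m) : subData ω T i + subData ω (U \ T) i = subData ω U i := by
  unfold subData
  rw [← Multiset.map_add, slice_sdiff, Finset.sdiff_val,
    add_tsub_cancel_of_le (Finset.val_le_iff.2 (slice_subset_slice h i))]

theorem mem_subData {ω : (Σ i, Fin (N i)) → Δ} {T : Finset (Σ i, Fin (N i))} {i : Fin m} {δ : Δ} :
    δ ∈ subData ω T i ↔ ∃ a, (⟨i, a⟩ : Σ i, Fin (N i)) ∈ T ∧ ω ⟨i, a⟩ = δ := by
  simp [subData]

theorem coe_ofFn {n : ℕ} (f : Fin n → Δ) :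
    (List.ofFn f : Multiset Δ) = Finset.univ.val.map f :=
  (Fin.univ_val_map f).symm

variable {A : Fin m → Δ → Set 𝒵} {M : (Fin m → List Δ) → 𝒵}

/-- Permutation invariance makes the arbitrary order chosen by `Multiset.toList` immaterial. -/
theorem IsConsistentScheme.eq_subDecision (hM : IsConsistentScheme A M)
    {ω : (Σ i, Fin (N i)) → Δ} {T : Finset (Σ i, Fin (N i))} {D : Fin m → List Δ}
    (h : ∀ i, (D i : Multiset Δ) = subData ω T i) : M D = subDecision M ω T :=
  hM.perm_invariant _ _ fun i => by
    rw [← Multiset.coe_eq_coe, h i, Multiset.coe_toList]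

theorem IsConsistentScheme.isSubsampleScheme [MeasurableSpace Δ] (hM : IsConsistentScheme A M)
    (hmeas : IsMeasurableScheme A M) :
    IsSubsampleScheme A (Sigma.fst : (Σ i, Fin (N i)) → Fin m) (subDecision M) where
  congr T ω ω' h := by unfold subDecision; rw [subData_congr h]
  eq_iff ω T U h := by
    set D : Fin m → List Δ := fun i => (subData ω T i).toList with hD
    set E : Fin m → List Δ := fun i => (subData ω (U \ T) i).toList with hE
    have h1 : M D = subDecision M ω T := rfl
    have h2 : M (fun i => D i ++ E i) = subDecision M ω U := by
      refine hM.eq_subDecision fun i => ?_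
      rw [← Multiset.coe_add, hD, hE, Multiset.coe_toList, Multiset.coe_toList,
        subData_add_sdiff ω h]
    rw [← h1, ← h2]
    constructor
    · intro heq x hx
      by_contra hxA
      refine hM.responsive D E ⟨x.1, ω x, ?_, hxA⟩ heq
      rw [hE, Multiset.mem_toList, mem_subData]
      exact ⟨x.2, hx, rfl⟩
    · intro hx
      refine hM.stable D E fun i δ hδ => ?_
      rw [hE, Multiset.mem_toList, mem_subData] at hδ
      obtain ⟨a, ha, rfl⟩ := hδ
      exact hx _ ha
  measurable T i := by
    -- Listing each slice of `T` in increasing order gives a sample of sizes `(slice T i).card`,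
    -- possibly zero, to which `hmeas` applies.
    set φ : ((Σ i, Fin (N i)) → Δ) → (i : Fin m) → Fin (slice T i).card → Δ :=
      fun ω i a => ω ⟨i, (slice T i).orderEmbOfFin rfl a⟩ with hφ
    have hφm : Measurable φ := by
      refine measurable_pi_lambda _ fun i => measurable_pi_lambda _ fun a => ?_
      exact measurable_pi_apply _
    have h1 : ∀ ω, M (toData (φ ω)) = subDecision M ω T := by
      refine fun ω => hM.eq_subDecision fun i => ?_
      rw [toData, coe_ofFn, subData]
      conv_rhs => rw [← Finset.map_orderEmbOfFin_univ (slice T i) rfl, Finset.map_val,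
        Multiset.map_map]
      rfl
    have := (hφm.comp measurable_fst).prodMk measurable_snd (hmeas (fun i => (slice T i).card) i)
    simpa only [preimage_ofPred_eq, Function.comp, h1] using this

theorem coe_eraseIdx_ofFn {n : ℕ} (f : Fin n → Δ) (j : Fin n) :
    ((List.ofFn f).eraseIdx j : Multiset Δ) = (Finset.univ.erase j).val.map f := by
  have hj : (j : ℕ) < (List.ofFn f).length := by simp
  have h1 := Multiset.coe_eq_coe.2 (List.getElem_cons_eraseIdx_perm hj)
  rw [coe_ofFn, ← Finset.insert_erase (Finset.mem_univ j),
    Finset.insert_val_of_notMem (Finset.notMem_erase _ _), Multiset.map_cons, ← Multiset.cons_coe,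
    List.getElem_ofFn] at h1
  exact (Multiset.cons_inj_right _).1 h1

theorem IsConsistentScheme.toData_eq_subDecision (hM : IsConsistentScheme A M)
    (ω : (Σ i, Fin (N i)) → Δ) : M (toData (Sigma.curry ω)) = subDecision M ω Finset.univ :=
  hM.eq_subDecision fun i => by rw [toData, coe_ofFn, subData, slice_univ]; rfl

/-- Support is a property of positions, not of values, so repeated scenarios cause no ambiguity. -/
theorem IsConsistentScheme.isSupport_iff (hM : IsConsistentScheme A M)
    (ω : (Σ i, Fin (N i)) → Δ) (i : Fin m) (j : Fin (N i)) :
    IsSupport M (toData (Sigma.curry ω)) i (Fin.cast (by simp [toData]) j) ↔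
      ⟨i, j⟩ ∈ supportSet (subDecision M) ω := by
  have h1 : M (Function.update (toData (Sigma.curry ω)) i
      ((toData (Sigma.curry ω) i).eraseIdx j)) =
      subDecision M ω (Finset.univ.erase ⟨i, j⟩) := by
    refine hM.eq_subDecision fun i' => ?_
    by_cases h : i' = i
    · subst h
      rw [Function.update_self, toData, coe_eraseIdx_ofFn, subData]
      have : slice (Finset.univ.erase (⟨i', j⟩ : Σ i, Fin (N i))) i' = Finset.univ.erase j := by
        ext; simp
      rw [this]; rfl
    · rw [Function.update_of_ne h, toData, coe_ofFn, subData]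
      have : slice (Finset.univ.erase (⟨i, j⟩ : Σ i, Fin (N i))) i' = Finset.univ := by
        ext; simp [h]
      rw [this]; rfl
  simp only [IsSupport, Fin.val_cast, h1, hM.toData_eq_subDecision, supportSet,
    Finset.mem_filter, Finset.mem_univ, true_and]

theorem IsConsistentScheme.coe_supportLists (hM : IsConsistentScheme A M)
    (ω : (Σ i, Fin (N i)) → Δ) (i : Fin m) :
    (supportLists M (toData (Sigma.curry ω)) i : Multiset Δ) =
      subData ω (supportSet (subDecision M) ω) i := by
  classical
  have hlen : N i = (toData (Sigma.curry ω) i).length := by simp [toData]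
  have h1 : Finset.univ.filter (fun j => IsSupport M (toData (Sigma.curry ω)) i j) =
      (slice (supportSet (subDecision M) ω) i).map (finCongr hlen).toEmbedding := by
    ext j
    obtain ⟨j, rfl⟩ := (finCongr hlen).surjective j
    rw [Finset.mem_map_equiv, Equiv.symm_apply_apply, mem_slice, ← hM.isSupport_iff]
    simp
  have h2 : (supportLists M (toData (Sigma.curry ω)) i : Multiset Δ) =
      (Finset.univ.filter (fun j => IsSupport M (toData (Sigma.curry ω)) i j)).val.map
        (toData (Sigma.curry ω) i).get := by
    rw [Finset.filter_val, Fin.univ_def, supportLists]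
    simp only [Multiset.filter_coe, Multiset.map_coe]
  rw [h2, h1, subData, Finset.map_val, Multiset.map_map]
  refine Multiset.map_congr rfl fun a _ => ?_
  simp [toData, Sigma.curry]
  rfl

theorem IsConsistentScheme.complexity_eq (hM : IsConsistentScheme A M)
    (ω : (Σ i, Fin (N i)) → Δ) :
    complexity M (toData (Sigma.curry ω)) =
      fun i => (slice (supportSet (subDecision M) ω) i).card := by
  funext i
  rw [complexity, ← Multiset.coe_card, hM.coe_supportLists, subData, Multiset.card_map]
  rfl

end Subdata

/-! ### The law of the sample and the probability bound -/

section Law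

variable {m : ℕ} {Δ : Type*} [MeasurableSpace Δ] {𝒵 : Type*}

theorem sampleLaw_eq_map (P : Measure Δ) [IsProbabilityMeasure P] (N : Fin m → ℕ) :
    sampleLaw P N = (Measure.pi fun _ : Σ i, Fin (N i) => P).map
      (MeasurableEquiv.piCurry fun (i : Fin m) (_ : Fin (N i)) => Δ) := by
  -- Currying is available for `infinitePi`, which agrees with `pi` on finite index types.
  have := Measure.infinitePi_map_piCurry fun (i : Fin m) (_ : Fin (N i)) => P
  rw [Measure.infinitePi_eq_pi] at this
  rw [this, sampleLaw, Measure.infinitePi_eq_pi]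
  congr 1
  funext i
  rw [Measure.infinitePi_eq_pi]

theorem jointRisk_le_sum (P : Measure Δ) [IsProbabilityMeasure P] {A : Fin m → Δ → Set 𝒵} {z : 𝒵}
    (hz : ∀ i, MeasurableSet {δ | z ∈ A i δ}) :
    jointRisk P A z ≤ ∑ i, (1 - appropriateness P A z i) := by
  have h1 : {δ | ∃ i, z ∉ A i δ} = ⋃ i, {δ | z ∈ A i δ}ᶜ := by ext; simp
  rw [jointRisk, h1]
  refine (measureReal_iUnion_fintype_le _).trans (Finset.sum_le_sum fun i _ => ?_)
  rw [probReal_compl_eq_one_sub (hz i)]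
  rfl

theorem measure_epsBar_lt_jointRisk (hm : 1 ≤ m) (P : Measure Δ) [IsProbabilityMeasure P]
    (A : Fin m → Δ → Set 𝒵) (M : (Fin m → List Δ) → 𝒵)
    (hmeas : IsMeasurableScheme A M) (hcons : IsConsistentScheme A M)
    (hnondeg : NonDegenerate P M) (N : Fin m → ℕ) (hN : ∀ i, 1 ≤ N i)
    (β : ℝ) (hβ : β ∈ Ioo (0 : ℝ) 1) :
    sampleLaw P N {ω | epsBar β N (complexity M (toData ω)) < jointRisk P A (M (toData ω))} ≤
      ENNReal.ofReal β := by
  have hz := hcons.isSubsampleScheme (N := N) hmeas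
  have hnd : ∀ᵐ ω ∂Measure.pi (fun _ : Σ i, Fin (N i) => P),
      subDecision M ω (supportSet (subDecision M) ω) = subDecision M ω Finset.univ := by
    have h := hnondeg N hN
    rw [sampleLaw_eq_map] at h
    filter_upwards [ae_of_ae_map (MeasurableEquiv.measurable _).aemeasurable h] with ω hω
    rw [MeasurableEquiv.coe_piCurry] at hω
    rw [← hcons.toData_eq_subDecision, ← hω]
    exact (hcons.eq_subDecision (hcons.coe_supportLists ω)).symm
  rw [sampleLaw_eq_map, MeasurableEquiv.map_apply]
  set τ : Finset (Σ i, Fin (N i)) → ℝ := fun T => tBar β (fun i => (slice T i).card) N N with hτ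
  calc _ ≤ Measure.pi (fun _ : Σ i, Fin (N i) => P)
        {ω | ∏ i, appropriateness P A (subDecision M ω Finset.univ) i <
          τ (supportSet (subDecision M) ω)} := by
        refine measure_mono fun ω hω => ?_
        have hω' : epsBar β N (complexity M (toData (Sigma.curry ω))) <
          jointRisk P A (M (toData (Sigma.curry ω))) := hω
        rw [hcons.complexity_eq, hcons.toData_eq_subDecision] at hω'
        refine prod_lt_tBar hm (fun i => measureReal_nonneg) measureReal_le_one
          (jointRisk_le_sum P fun i => ?_) hω'
        exact (measurable_const.prodMk measurable_id) (hz.measurable Finset.univ i)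
    _ ≤ ∑ U, ENNReal.ofReal (dualWeight β U) := by
        refine hz.measure_supportSet_le hnd τ _ (fun T hT i => ?_) fun T c hc hprod => ?_
        -- A positive threshold means that `T` does not exhaust label `i`.
        · have h := lt_of_tBar_pos hT i
          obtain ⟨a, ha⟩ : ∃ a, a ∉ slice T i := by
            by_contra! hall
            rw [Finset.eq_univ_iff_forall.2 hall] at h
            simp at h
          exact ⟨⟨i, a⟩, fun h => ha (mem_slice.2 h), rfl⟩
        · have hpos : ∀ i, 0 < (c i).toReal := fun i =>
            ENNReal.toReal_pos (hc i).1.ne' ((hc i).2.trans_lt ENNReal.one_lt_top).ne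
          have hcr : ∀ i, c i = ENNReal.ofReal (c i).toReal := fun i =>
            (ENNReal.ofReal_toReal ((hc i).2.trans_lt ENNReal.one_lt_top).ne).symm
          have hprod' : ∀ S : Finset (Σ i, Fin (N i)), ∏ x ∈ S, c x.1 =
              ENNReal.ofReal (∏ x ∈ S, (c x.1).toReal) := by
            intro S
            rw [ENNReal.ofReal_prod_of_nonneg fun x _ => ENNReal.toReal_nonneg]
            exact Finset.prod_congr rfl fun x _ => hcr x.1
          simp_rw [hprod', ← ENNReal.ofReal_mul (dualWeight_nonneg hβ.1.le _)]
          rw [← ENNReal.ofReal_sum_of_nonneg fun U _ => mul_nonneg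
            (dualWeight_nonneg hβ.1.le _) (Finset.prod_nonneg fun x _ => ENNReal.toReal_nonneg)]
          exact ENNReal.ofReal_le_ofReal (le_sum_dualWeight hm hβ T hpos hprod)
    _ = ENNReal.ofReal β := by
        rw [← ENNReal.ofReal_sum_of_nonneg fun U _ => dualWeight_nonneg hβ.1.le U,
          sum_dualWeight hm hN]

end Law

end MultiCriteria

theorem proposition2 {m : ℕ} (hm : 1 ≤ m)
    {Δ : Type*} [MeasurableSpace Δ] (P : Measure Δ) [IsProbabilityMeasure P]
    {𝒵 : Type*} (A : Fin m → Δ → Set 𝒵) (M : (Fin m → List Δ) → 𝒵)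
    (hmeas : MultiCriteria.IsMeasurableScheme A M)
    (hcons : MultiCriteria.IsConsistentScheme A M)
    (hnondeg : MultiCriteria.NonDegenerate P M)
    (N : Fin m → ℕ) (hN : ∀ i, 1 ≤ N i)
    (β : ℝ) (hβ : β ∈ Ioo (0 : ℝ) 1) :
    (∀ k : Fin m → ℕ, (∀ i, k i < N i) →
      ∃! t : ℝ, t ∈ Ioo 0 (MultiCriteria.tHat k N) ∧ MultiCriteria.psi β k N N t = 0) ∧
    1 - β ≤ (MultiCriteria.sampleLaw P N).real
      {ω | MultiCriteria.jointRisk P A (M (MultiCriteria.toData ω)) ≤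
        MultiCriteria.epsBar β N (MultiCriteria.complexity M (MultiCriteria.toData ω))} := by
  refine ⟨fun k hk => MultiCriteria.existsUnique_psi_eq_zero hm hβ hk, ?_⟩
  have : IsProbabilityMeasure (MultiCriteria.sampleLaw P N) := by
    unfold MultiCriteria.sampleLaw; infer_instance
  set S := {ω | MultiCriteria.jointRisk P A (M (MultiCriteria.toData ω)) ≤
    MultiCriteria.epsBar β N (MultiCriteria.complexity M (MultiCriteria.toData (N := N) ω))}
  have h1 : (MultiCriteria.sampleLaw P N).real Sᶜ ≤ β := by
    refine ENNReal.toReal_le_of_le_ofReal hβ.1.le (le_trans (measure_mono fun ω hω => ?_)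
      (MultiCriteria.measure_epsBar_lt_jointRisk hm P A M hmeas hcons hnondeg N hN β hβ))
    simpa only [S, mem_compl_iff, mem_ofPred_eq, not_le] using hω
  -- Subadditivity replaces the complement rule, so `S` need not be measurable.
  have h2 := measureReal_union_le (μ := MultiCriteria.sampleLaw P N) S Sᶜ
  rw [union_compl_self, probReal_univ] at h2
  linarith
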